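/- Let $d\ge 1$ and equip $\Omega=[0,1]^d$ with the metric $\rho(x,y)=\|x-y\|_\infty$. For probability measures, $W_1(\mu,\nu)=\inf_\gamma\int\rho\,d\gamma$, the infimum being over all couplings $\gamma$ of $\mu$ and $\nu$. For signed measures, $d_{\mathrm{BL}}(\mu,\nu)=\sup_f\left(\int f\,d\mu-\int f\,d\nu\right)$, the supremum being over all $f:\Omega\to\mathbb R$ with Lipschitz constant at most $1$ and $\|f\|_\infty\le\operatorname{diam}(\Omega)$. For $\sigma>0$, the discrete Laplace distribution $\mathrm{Lap}_{\mathbb Z}(\sigma)$ has mass $\frac{1-p}{1+p}e^{-|z|/\sigma}$ at $z\in\mathbb Z$, where $p=e^{-1/\sigma}$. Private signed measure mechanism (PSMM). The input is a dataset $\mathcal X=(x_1,\dots,x_n)\in\Omega^n$ with $n\ge1$, a privacy parameter $\varepsilon>0$, a partition $(\Omega_1,\dots,\Omega_m)$ of $\Omega$ into non-empty cells, and points $y_i\in\Omega_i$ chosen independently of $\mathcal X$. Let $n_i=\#\{j:x_j\in\Omega_i\}$, let $\lambda_1,\dots,\lambda_m$ be i.i.d. with law $\mathrm{Lap}_{\mathbb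 Z}(1/\varepsilon)$, and let $\nu=\sum_{i=1}^m\frac{n_i+\lambda_i}{n}\delta_{y_i}$, a random signed measure. The output $\hat\nu$ is a (random) probability measure on $\{y_1,\dots,y_m\}$ which is closest to $\nu$ in $d_{\mathrm{BL}}$ among all probability measures on $\{y_1,\dots,y_m\}$; ties may be broken arbitrarily. Claim. For all constants $a,b>0$ there is a constant $C>0$, depending only on $a$ and $b$, such that the following holds for all $d$, $n$, $\varepsilon$, $\mathcal X$. Let $m=\lceil\varepsilon n\rceil$, let $(\Omega_1,\dots,\Omega_m)$ be a partition of $[0,1]^d$ with $a\,m^{-1/d}\le\operatorname{diam}(\Omega_i)\le b\,m^{-1/d}$ for all $i$, and let $y_i\in\Omega_i$ be arbitrary. Then, with $\mu_{\mathcal X}=\frac1n\sum_{j=1}^n\delta_{x_j}$, $$\mathbb E\,W_1(\mu_{\mathcal X},\hat\nu)\le\begin{cases}C(\varepsilon n)^{-1/2}&\text{if }d=1,\\ C\log(\varepsilon n)\,(\varepsilon n)^{-1/2}&\text{if }d=2\text{ and }\varepsilon n\ge2,\\ C(\varepsilon n)^{-1/d}&\text{if }d\ge3.\end{cases}$$ 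-/

import Mathlib

open MeasureTheory ProbabilityTheory
open scoped ENNReal NNReal

namespace PSMM

/-- The cube `[0,1]^d`. The instance metric on this function type is the `ℓ^∞` metric. -/
abbrev Cube (d : ℕ) : Type := Fin d → Set.Icc (0 : ℝ) 1

/-! ### The discrete Laplace distribution -/

/-- The discrete Laplace distribution with scale `σ`: the measure on `ℤ` with mass
`(1 - p) / (1 + p) * exp (-|z| / σ)` at `z`, where `p = exp (-1 / σ)`. -/
noncomputable def discreteLaplace (σ : ℝ) : Measure ℤ :=
  Measure.sum fun z : ℤ =>
    ENNReal.ofReal ((1 - Real.exp (-1 / σ)) / (1 + Real.exp (-1 / σ)) * Real.exp (-|(z : ℝ)| / σ)) •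
      Measure.dirac z

theorem hasSum_discreteLaplace {σ : ℝ} (hσ : 0 < σ) :
    HasSum (fun z : ℤ => (1 - Real.exp (-1 / σ)) / (1 + Real.exp (-1 / σ)) *
      Real.exp (-|(z : ℝ)| / σ)) 1 := by
  set p := Real.exp (-1 / σ) with hp
  have hp0 : 0 < p := Real.exp_pos _
  have hp1 : p < 1 := Real.exp_lt_one_iff.2 (div_neg_of_neg_of_pos (by norm_num) hσ)
  have key : ∀ k : ℕ, Real.exp (-(k : ℝ) / σ) = p ^ k := by
    intro k
    rw [hp, ← Real.exp_nat_mul]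
    congr 1
    ring
  have h0 := hasSum_geometric_of_lt_one hp0.le hp1
  have h1 : HasSum (fun k : ℕ => Real.exp (-|((k : ℤ) : ℝ)| / σ)) (1 - p)⁻¹ := by
    convert h0 using 2 with k
    rw [Int.cast_natCast, Nat.abs_cast, key]
  have h2 : HasSum (fun k : ℕ => Real.exp (-|((-((k : ℤ) + 1) : ℤ) : ℝ)| / σ)) (p * (1 - p)⁻¹) := by
    have e : ∀ k : ℕ, Real.exp (-|((-((k : ℤ) + 1) : ℤ) : ℝ)| / σ) = p * p ^ k := by
      intro k
      have e' : |((-((k : ℤ) + 1) : ℤ) : ℝ)| = ((k + 1 : ℕ) : ℝ) := by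
        push_cast
        rw [abs_neg, abs_of_nonneg (by positivity)]
      rw [e', key, pow_succ']
    simpa only [e] using h0.mul_left p
  have h3 := (HasSum.of_nat_of_neg_add_one (f := fun z : ℤ => Real.exp (-|(z : ℝ)| / σ)) h1
    h2).mul_left ((1 - p) / (1 + p))
  have hm : 1 - p ≠ 0 := by linarith
  have hq : 1 + p ≠ 0 := by linarith
  have e : (1 - p) / (1 + p) * ((1 - p)⁻¹ + p * (1 - p)⁻¹) = 1 := by
    field_simp
  rwa [e] at h3

theorem isProbabilityMeasure_discreteLaplace {σ : ℝ} (hσ : 0 < σ) :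
    IsProbabilityMeasure (discreteLaplace σ) := by
  refine ⟨?_⟩
  have h := hasSum_discreteLaplace hσ
  have hp1 : Real.exp (-1 / σ) < 1 :=
    Real.exp_lt_one_iff.2 (div_neg_of_neg_of_pos (by norm_num) hσ)
  have hn : ∀ z : ℤ, 0 ≤ (1 - Real.exp (-1 / σ)) / (1 + Real.exp (-1 / σ)) *
      Real.exp (-|(z : ℝ)| / σ) := fun z =>
    mul_nonneg (div_nonneg (by linarith) (by positivity)) (Real.exp_pos _).le
  simp only [discreteLaplace, Measure.sum_apply _ MeasurableSet.univ, Measure.smul_apply,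
    measure_univ, smul_eq_mul, mul_one]
  rw [← ENNReal.ofReal_tsum_of_nonneg hn h.summable, h.tsum_eq, ENNReal.ofReal_one]

/-! ### Distances between measures -/

section Distances

variable {Ω : Type*} [MeasurableSpace Ω]

/-- The 1-Wasserstein distance: the infimum, over all couplings `γ` of `μ` and `ν`, of the
transport cost `∫ ρ(x, y) dγ(x, y)`. -/
noncomputable def wasserstein [PseudoEMetricSpace Ω] (μ ν : Measure Ω) : ℝ≥0∞ :=
  ⨅ (γ : Measure (Ω × Ω)) (_ : γ.fst = μ ∧ γ.snd = ν), ∫⁻ p, edist p.1 p.2 ∂γ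

/-- The class of functions `f` with `max (Lip f) (‖f‖_∞ / diam Ω) ≤ 1`. -/
def lipBall (Ω : Type*) [PseudoMetricSpace Ω] : Set (Ω → ℝ) :=
  {f | LipschitzWith 1 f ∧ ∀ x, |f x| ≤ Metric.diam (Set.univ : Set Ω)}

/-- The bounded Lipschitz distance of two signed measures on a bounded metric space. -/
noncomputable def dBL [PseudoMetricSpace Ω] (μ ν : SignedMeasure Ω) : ℝ :=
  ⨆ f : lipBall Ω, ((∫ᵛ x, (f : Ω → ℝ) x ∂<•μ) - ∫ᵛ x, (f : Ω → ℝ) x ∂<•ν)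

/-- `p` is, among the probability measures carried by the set `S`, one that is closest to the
signed measure `ν` in the bounded Lipschitz distance. -/
def IsClosestProbabilityOn [PseudoMetricSpace Ω] (S : Set Ω) (ν : SignedMeasure Ω)
    (p : ProbabilityMeasure Ω) : Prop :=
  (p : Measure Ω) Sᶜ = 0 ∧
    ∀ q : ProbabilityMeasure Ω, (q : Measure Ω) Sᶜ = 0 →
      dBL (p : Measure Ω).toSignedMeasure ν ≤ dBL (q : Measure Ω).toSignedMeasure ν

end Distances

/-! ### The private signed measure mechanism -/

section Mechanism

variable {Ω : Type*} [MeasurableSpace Ω] {n m : ℕ}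

/-- The empirical measure `(1 / n) ∑ δ_{x_j}` of a dataset. -/
noncomputable def empirical (x : Fin n → Ω) : Measure Ω :=
  (n : ℝ≥0∞)⁻¹ • ∑ j, Measure.dirac (x j)

/-- `(Ω_1, …, Ω_m)` is a partition of the space. -/
def IsPartition (cell : Fin m → Set Ω) : Prop :=
  (∀ i, (cell i).Nonempty) ∧ Pairwise (Function.onFun Disjoint cell) ∧ ⋃ i, cell i = Set.univ

/-- The true count of the data points in the `i`-th cell. -/
noncomputable def cellCount (cell : Fin m → Set Ω) (x : Fin n → Ω) (i : Fin m) : ℕ :=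
  {j | x j ∈ cell i}.ncard

/-- The perturbed signed measure, with mass `(n_i + l_i) / n` at `y_i`. -/
noncomputable def noisyMeasure (cell : Fin m → Set Ω) (y : Fin m → Ω) (x : Fin n → Ω)
    (l : Fin m → ℤ) : SignedMeasure Ω :=
  ∑ i, VectorMeasure.dirac (y i) (((cellCount cell x i : ℝ) + (l i : ℝ)) / (n : ℝ))

/-- The random measure `νhat` is generated by the private signed measure mechanism with privacy
parameter `ε` from the data `x`, the cells `cell` and the points `y i ∈ cell i`: there are i.i.d.
discrete Laplace variables `lam i` with scale `1 / ε` such that `νhat` is almost surely a closest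
probability measure on `{y_1, …, y_m}` to the signed measure obtained by adding `lam i` to the
`i`-th count. Ties between closest measures may be broken in any way. -/
def IsOutput [PseudoMetricSpace Ω] {S : Type*} [MeasurableSpace S] (P : Measure S) (ε : ℝ)
    (cell : Fin m → Set Ω) (y : Fin m → Ω) (x : Fin n → Ω)
    (νhat : S → ProbabilityMeasure Ω) : Prop :=
  Measurable νhat ∧
    ∃ lam : Fin m → S → ℤ,
      (∀ i, HasLaw (lam i) (discreteLaplace (1 / ε)) P) ∧ iIndepFun lam P ∧
        ∀ᵐ s ∂P, IsClosestProbabilityOn (Set.range y)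
          (noisyMeasure cell y x fun i => lam i s) (νhat s)

end Mechanism

end PSMM

/-! Moving each data point `x_j` to the representative `y_i` of its cell changes the integral of a
1-Lipschitz function by at most the mesh δ, and the resulting measure is a competitor in the
minimisation defining `νhat`. Let D bound `(∑ λ_i f(y_i)) / n` over all f in `lipBall`. The
competitor is within D of the noisy measure, hence so is `νhat`. Testing against 1-Lipschitz
functions, recentred so as to lie in `lipBall`, and applying Kantorovich duality gives W₁ ≤ δ + 2D
(`wasserstein_empirical_le`).

The noise is controlled by chaining along dyadic grids (`sum_mul_le_sum_gridFiber`): f telescopes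
through its values at cell corners, and level k costs `2^(-k)` times the sum of absolute noise
totals over the `2^(kd)` cells. The noises are centred and independent with second moment at most
`(2/ε)²`, so the expected cost is at most `(2/ε) 2^(-k) √(2^(kd) m)`, and stopping at level K leaves
at most `(2/ε) 2^(-K) m`.

The levels form a geometric sum of ratio `2^(d/2-1)`, which is below, equal to or above 1 for d = 1,
d = 2, d ≥ 3: the coarse scales dominate, all scales contribute equally (whence the logarithm), or
the finest scale, of size about `m^(-1/d)`, dominates. -/

namespace PSMM

/-! ### Kantorovich duality for finite supports -/

section Duality

open Pointwise in
/-- Kantorovich duality for finitely supported probability measures: if every admissible pair of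
potentials has dual value at most `B`, then some coupling has cost at most `B`. -/
theorem exists_coupling_cost_le {J I : Type*} [Fintype J] [Fintype I]
    (a : J → ℝ) (q : I → ℝ) (c : J → I → ℝ) (B : ℝ)
    (ha : ∀ j, 0 ≤ a j) (ha1 : ∑ j, a j = 1) (hq : ∀ i, 0 ≤ q i) (hq1 : ∑ i, q i = 1)
    (h : ∀ (u : J → ℝ) (v : I → ℝ), (∀ j i, u j + v i ≤ c j i) →
      ∑ j, a j * u j + ∑ i, q i * v i ≤ B) :
    ∃ π : J × I → ℝ, (∀ p, 0 ≤ π p) ∧ (∀ j, ∑ i, π (j, i) = a j) ∧ (∀ i, ∑ j, π (j, i) = q i) ∧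
      ∑ p, π p * c p.1 p.2 ≤ B := by
  classical
  let L : (J × I → ℝ) →ₗ[ℝ] (J → ℝ) × (I → ℝ) × ℝ :=
    { toFun := fun π => (fun j => ∑ i, π (j, i), fun i => ∑ j, π (j, i), ∑ p, π p * c p.1 p.2)
      map_add' := fun π ρ => by
        ext <;> simp [Finset.sum_add_distrib, add_mul]
      map_smul' := fun r π => by
        ext <;> simp [Finset.mul_sum, mul_assoc] }
  have hL : ∀ π, L π =
    (fun j => ∑ i, π (j, i), fun i => ∑ j, π (j, i), ∑ p, π p * c p.1 p.2) := fun _ => rfl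
  -- Adding a ray in the cost coordinate turns "cost at most B" into membership. Starting from the
  -- compact simplex rather than the nonnegative orthant makes the sum with this closed ray closed.
  let R : Set ((J → ℝ) × (I → ℝ) × ℝ) := {0} ×ˢ {0} ×ˢ Set.Ici 0
  by_contra hcon
  have hnot : (a, q, B) ∉ L '' stdSimplex ℝ (J × I) + R := by
    rintro ⟨_, ⟨π, hπ, rfl⟩, ⟨r₁, r₂, r⟩, ⟨h₁, h₂, hr⟩, e⟩
    simp only [Set.mem_singleton_iff, Set.mem_Ici] at h₁ h₂ hr
    subst h₁ h₂
    simp only [hL, Prod.mk_add_mk, add_zero, Prod.mk.injEq] at e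
    refine hcon ⟨π, hπ.1, fun j => congrFun e.1 j, fun i => congrFun e.2.1 i, ?_⟩
    linarith [e.2.2]
  have hconv : Convex ℝ (L '' stdSimplex ℝ (J × I) + R) :=
    ((convex_stdSimplex ℝ _).linear_image L).add
      ((convex_singleton 0).prod ((convex_singleton 0).prod (convex_Ici 0)))
  have hclosed : IsClosed (L '' stdSimplex ℝ (J × I) + R) :=
    IsClosed.add_left_of_isCompact (isClosed_singleton.prod (isClosed_singleton.prod isClosed_Ici))
      ((isCompact_stdSimplex ℝ _).image L.continuous_of_finiteDimensional)
  obtain ⟨f, θ, hlt, hgt⟩ := geometric_hahn_banach_point_closed hconv hclosed hnot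
  set u : J → ℝ := fun j => f (Pi.single j 1, 0, 0) with hu
  set v : I → ℝ := fun i => f (0, Pi.single i 1, 0) with hv
  set s : ℝ := f (0, 0, 1) with hs
  have hf : ∀ (α : J → ℝ) (β : I → ℝ) (t : ℝ),
      f (α, β, t) = ∑ j, α j * u j + ∑ i, β i * v i + t * s := by
    intro α β t
    have e1 : (α, β, t) = ∑ j, α j • ((Pi.single j 1, 0, 0) : (J → ℝ) × (I → ℝ) × ℝ) +
        ∑ i, β i • ((0, Pi.single i 1, 0) : (J → ℝ) × (I → ℝ) × ℝ) + t • (0, 0, 1) := by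
      ext <;> simp [Prod.fst_sum, Prod.snd_sum, Finset.sum_apply, Pi.single_apply]
    rw [e1, map_add, map_add, map_sum, map_sum]
    simp only [map_smul, smul_eq_mul, hu, hv, hs]
  have key : ∀ j i (r : ℝ), 0 ≤ r → θ < u j + v i + (c j i + r) * s := by
    intro j i r hr
    have := hgt (L (Pi.single (j, i) 1) + (0, 0, r)) (Set.add_mem_add
      ⟨_, single_mem_stdSimplex ℝ (j, i), rfl⟩ ⟨rfl, rfl, hr⟩)
    rw [hL, Prod.mk_add_mk, Prod.mk_add_mk, hf] at this
    have e2 : (∑ p : J × I, (Pi.single (j, i) 1 : J × I → ℝ) p * c p.1 p.2) = c j i := by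
      simp [Pi.single_apply]
    have e3 : ∀ j', (∑ i', (Pi.single (j, i) 1 : J × I → ℝ) (j', i')) = if j' = j then 1 else 0 := by
      intro j'
      by_cases hj : j' = j <;> simp [Pi.single_apply, hj]
    have e4 : ∀ i', (∑ j', (Pi.single (j, i) 1 : J × I → ℝ) (j', i')) = if i' = i then 1 else 0 := by
      intro i'
      by_cases hi : i' = i <;> simp [Pi.single_apply, hi]
    simpa [e2, e3, e4] using this
  -- The product coupling shows that the separating functional really sees the cost: if s = 0, it
  -- takes the same value there as at `(a, q, B)`, against strict separation.
  have hprod : θ < ∑ j, a j * u j + ∑ i, q i * v i + (∑ j, ∑ i, a j * q i * c j i) * s := by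
    have := hgt (L (fun p => a p.1 * q p.2) + (0, 0, 0)) (Set.add_mem_add
      ⟨_, ⟨fun p => mul_nonneg (ha _) (hq _), ?_⟩, rfl⟩ ⟨rfl, rfl, le_refl (0 : ℝ)⟩)
    · rw [hL, Prod.mk_add_mk, Prod.mk_add_mk, hf] at this
      simpa [← Finset.mul_sum, ← Finset.sum_mul, ha1, hq1, Fintype.sum_prod_type] using this
    · rw [Fintype.sum_prod_type]
      simp [← Finset.mul_sum, ha1, hq1]
  rw [hf] at hlt
  obtain ⟨j₀⟩ : Nonempty J := by
    by_contra hJ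
    rw [not_nonempty_iff] at hJ
    simp at ha1
  obtain ⟨i₀⟩ : Nonempty I := by
    by_contra hI
    rw [not_nonempty_iff] at hI
    simp at hq1
  have hs0 : 0 ≤ s := by
    by_contra hneg
    push Not at hneg
    have h0 := key j₀ i₀ 0 le_rfl
    -- This r makes the right-hand side of `key` equal to θ, so a negative s would give θ < θ.
    have := key j₀ i₀ ((u j₀ + v i₀ + c j₀ i₀ * s - θ) / (-s))
      (div_nonneg (by linarith) (by linarith))
    rw [add_mul, div_mul_eq_mul_div, div_neg, mul_div_assoc, div_self hneg.ne] at this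
    linarith
  have hs1 : 0 < s := by
    rcases hs0.eq_or_lt with h0 | h0
    · rw [← h0] at hlt hprod
      linarith
    · exact h0
  -- Dividing by s normalises the functional; θ can be absorbed into the first potential because the
  -- weights `a j` sum to 1.
  have := h (fun j => (θ - u j) / s) (fun i => -v i / s) (fun j i => by
    rw [← add_div, div_le_iff₀ hs1]
    linarith [key j i 0 le_rfl])
  have e5 : ∑ j, a j * ((θ - u j) / s) + ∑ i, q i * (-v i / s) =
      (θ - ∑ j, a j * u j - ∑ i, q i * v i) / s := by
    have e6 : ∑ j, a j * ((θ - u j) / s) = (∑ j, a j * θ - ∑ j, a j * u j) / s := by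
      rw [← Finset.sum_sub_distrib, Finset.sum_div]
      exact Finset.sum_congr rfl fun j _ => by ring
    have e7 : ∑ i, q i * (-v i / s) = -(∑ i, q i * v i) / s := by
      rw [← Finset.sum_neg_distrib, Finset.sum_div]
      exact Finset.sum_congr rfl fun j _ => by ring
    rw [e6, e7, ← Finset.sum_mul, ha1]
    ring
  rw [e5, div_le_iff₀ hs1] at this
  linarith

variable {Ω : Type*} [PseudoMetricSpace Ω]

/-- The infimum of finitely many functions `z ↦ dist z (y i) - v i` is `1`-Lipschitz. -/
theorem lipschitzWith_inf_dist_sub {I : Type*} [Fintype I] [Nonempty I] (y : I → Ω) (v : I → ℝ) :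
    LipschitzWith 1 fun z =>
      Finset.univ.inf' Finset.univ_nonempty fun i => dist z (y i) - v i := by
  refine LipschitzWith.of_le_add fun z w => ?_
  rw [← sub_le_iff_le_add]
  refine Finset.le_inf' _ _ fun i hi => ?_
  rw [sub_le_iff_le_add]
  refine (Finset.inf'_le _ hi).trans ?_
  linarith [dist_triangle z w (y i)]

variable [MeasurableSpace Ω] [MeasurableSingletonClass Ω]

/-- A dual pair (u, v) can be replaced by one function: `z ↦ min_i (dist z (y i) - v i)` is at least
`u j` at `x j` and at most `-v i` at `y i`, so the dual value does not decrease. -/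
theorem wasserstein_le_of_forall_lipschitzWith {J I : Type*} [Fintype J] [Fintype I]
    (x : J → Ω) (y : I → Ω) (a : J → ℝ) (q : I → ℝ) (B : ℝ)
    (ha : ∀ j, 0 ≤ a j) (ha1 : ∑ j, a j = 1) (hq : ∀ i, 0 ≤ q i) (hq1 : ∑ i, q i = 1)
    (h : ∀ f : Ω → ℝ, LipschitzWith 1 f → ∑ j, a j * f (x j) - ∑ i, q i * f (y i) ≤ B) :
    wasserstein (∑ j, ENNReal.ofReal (a j) • Measure.dirac (x j))
      (∑ i, ENNReal.ofReal (q i) • Measure.dirac (y i)) ≤ ENNReal.ofReal B := by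
  classical
  have : Nonempty I := by
    by_contra hI
    rw [not_nonempty_iff] at hI
    simp at hq1
  obtain ⟨π, hπ0, hπa, hπq, hπB⟩ := exists_coupling_cost_le a q (fun j i => dist (x j) (y i)) B
    ha ha1 hq hq1 (by
      intro u v huv
      refine le_trans ?_ (h _ (lipschitzWith_inf_dist_sub y v))
      rw [sub_eq_add_neg, ← Finset.sum_neg_distrib]
      refine add_le_add (Finset.sum_le_sum fun j _ => mul_le_mul_of_nonneg_left ?_ (ha j))
        (Finset.sum_le_sum fun i hi => ?_)
      · exact Finset.le_inf' _ _ fun i _ => by linarith [huv j i]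
      · rw [← mul_neg]
        refine mul_le_mul_of_nonneg_left ?_ (hq i)
        rw [le_neg]
        refine (Finset.inf'_le _ hi).trans ?_
        simp)
  refine iInf₂_le_of_le
    (∑ p : J × I, ENNReal.ofReal (π p) • Measure.dirac (x p.1, y p.2)) ⟨?_, ?_⟩ ?_
  · ext s hs
    rw [Measure.fst_apply hs]
    simp only [Measure.coe_finsetSum, Finset.sum_apply, Measure.smul_apply, smul_eq_mul]
    rw [Fintype.sum_prod_type]
    refine Finset.sum_congr rfl fun j _ => ?_
    rw [← hπa j, ENNReal.ofReal_sum_of_nonneg fun i _ => hπ0 _, Finset.sum_mul]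
    refine Finset.sum_congr rfl fun i _ => ?_
    rw [Measure.dirac_apply' _ (measurable_fst hs), Measure.dirac_apply' _ hs]
    rfl
  · ext s hs
    rw [Measure.snd_apply hs]
    simp only [Measure.coe_finsetSum, Finset.sum_apply, Measure.smul_apply, smul_eq_mul]
    rw [Fintype.sum_prod_type_right]
    refine Finset.sum_congr rfl fun i _ => ?_
    rw [← hπq i, ENNReal.ofReal_sum_of_nonneg fun i _ => hπ0 _, Finset.sum_mul]
    refine Finset.sum_congr rfl fun i _ => ?_
    rw [Measure.dirac_apply' _ (measurable_snd hs), Measure.dirac_apply' _ hs]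
    rfl
  · rw [lintegral_finsetSum_measure]
    simp only [lintegral_smul_measure, lintegral_dirac, smul_eq_mul, edist_dist]
    simp only [← ENNReal.ofReal_mul (hπ0 _)]
    rw [← ENNReal.ofReal_sum_of_nonneg fun p _ => mul_nonneg (hπ0 p) dist_nonneg]
    exact ENNReal.ofReal_le_ofReal hπB

end Duality

/-! ### Integrals against finitely supported measures -/

section FiniteSupport

variable {Ω : Type*} [MeasurableSpace Ω]

theorem empirical_eq_sum_ofReal {n : ℕ} (hn : 0 < n) (x : Fin n → Ω) :
    empirical x = ∑ j, ENNReal.ofReal ((n : ℝ)⁻¹) • Measure.dirac (x j) := by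
  rw [empirical, Finset.smul_sum, ENNReal.ofReal_inv_of_pos (by positivity), ENNReal.ofReal_natCast]

theorem isProbabilityMeasure_empirical {n : ℕ} (hn : 0 < n) (x : Fin n → Ω) :
    IsProbabilityMeasure (empirical x) := by
  refine ⟨?_⟩
  simp only [empirical, Measure.smul_apply, Measure.coe_finsetSum, Finset.sum_apply, measure_univ,
    Finset.sum_const, Finset.card_univ, Fintype.card_fin, nsmul_eq_mul, mul_one, smul_eq_mul]
  exact ENNReal.inv_mul_cancel (by exact_mod_cast hn.ne') (ENNReal.natCast_ne_top n)

variable [MeasurableSingletonClass Ω]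

theorem eq_sum_smul_dirac_of_compl_range {I : Type*} [Fintype I] {y : I → Ω}
    (hy : Function.Injective y) (p : Measure Ω) [IsFiniteMeasure p] (hp : p (Set.range y)ᶜ = 0) :
    p = ∑ i, ENNReal.ofReal (p.real {y i}) • Measure.dirac (y i) := by
  classical
  ext s hs
  have h1 : p s = p (⋃ i, s ∩ {y i}) := by
    rw [← Set.inter_iUnion, Set.iUnion_singleton_eq_range]
    exact (measure_inter_conull hp).symm
  rw [h1, measure_iUnion (fun i j hij => Set.disjoint_left.2 fun z hz hz' =>
    hij (hy (hz.2.symm.trans hz'.2))) fun i => hs.inter (measurableSet_singleton _), tsum_fintype]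
  simp only [Measure.coe_finsetSum, Finset.sum_apply, Measure.smul_apply, smul_eq_mul]
  refine Finset.sum_congr rfl fun i _ => ?_
  rw [Measure.dirac_apply' _ hs, ofReal_measureReal]
  by_cases hi : y i ∈ s
  · rw [Set.inter_eq_right.2 (Set.singleton_subset_iff.2 hi)]
    simp [hi]
  · rw [Set.inter_singleton_eq_empty.2 hi]
    simp [hi]

theorem integral_empirical {n : ℕ} (x : Fin n → Ω) (f : Ω → ℝ) :
    ∫ z, f z ∂empirical x = (n : ℝ)⁻¹ * ∑ j, f (x j) := by
  rw [empirical, integral_smul_measure, integral_finsetSum_measure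
    fun j _ => integrable_dirac (by simp)]
  simp

theorem integral_sum_ofReal_smul_dirac {I : Type*} [Fintype I] {y : I → Ω} {q : I → ℝ}
    (hq : ∀ i, 0 ≤ q i) (f : Ω → ℝ) :
    ∫ z, f z ∂(∑ i, ENNReal.ofReal (q i) • Measure.dirac (y i)) = ∑ i, q i * f (y i) := by
  rw [integral_finsetSum_measure fun j _ =>
    (integrable_dirac (by simp)).smul_measure ENNReal.ofReal_ne_top]
  refine Finset.sum_congr rfl fun i _ => ?_
  rw [integral_smul_measure, integral_dirac, ENNReal.toReal_ofReal (hq i), smul_eq_mul]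

theorem integral_noisyMeasure {n m : ℕ} (cell : Fin m → Set Ω) (y : Fin m → Ω) (x : Fin n → Ω)
    (l : Fin m → ℤ) (f : Ω → ℝ) :
    ∫ᵛ z, f z ∂<•noisyMeasure cell y x l =
      ∑ i, ((cellCount cell x i : ℝ) + l i) / n * f (y i) := by
  rw [noisyMeasure, VectorMeasure.integral_finsetSum_vectorMeasure]
  · refine Finset.sum_congr rfl fun i _ => ?_
    rw [VectorMeasure.integral_dirac]
    simp [mul_comm]
  · intro i _
    show Integrable _ _
    rw [VectorMeasure.variation_dirac]
    exact (integrable_dirac (by simp)).smul_measure enorm_ne_top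

end FiniteSupport

/-! ### Deterministic error bound for the mechanism -/

section Mechanism

variable {Ω : Type*} [PseudoMetricSpace Ω] {n m : ℕ}

theorem neg_mem_lipBall {f : Ω → ℝ} (hf : f ∈ lipBall Ω) : (fun z => -f z) ∈ lipBall Ω :=
  ⟨hf.1.neg, fun x => by rw [abs_neg]; exact hf.2 x⟩

/-- Recentring at z makes the sup bound automatic. Differences of integrals against two probability
measures ignore the constant, so passing from W₁ to bounded Lipschitz test functions loses nothing.
-/
theorem sub_const_mem_lipBall [BoundedSpace Ω] {f : Ω → ℝ} (hf : LipschitzWith 1 f) (z : Ω) :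
    (fun w => f w - f z) ∈ lipBall Ω := by
  refine ⟨by simpa using hf.sub (LipschitzWith.const (f z)), fun w => ?_⟩
  have := hf.dist_le_mul w z
  rw [Real.dist_eq, NNReal.coe_one, one_mul] at this
  exact this.trans (Metric.dist_le_diam_of_mem (Bornology.IsBounded.all _)
    (Set.mem_univ _) (Set.mem_univ _))

variable [MeasurableSpace Ω] [MeasurableSingletonClass Ω]

/-- The point is boundedness of the family: a real supremum over an unbounded family would default
to 0. -/
theorem le_dBL_noisyMeasure (cell : Fin m → Set Ω) (y : Fin m → Ω) (x : Fin n → Ω)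
    (l : Fin m → ℤ) (p : ProbabilityMeasure Ω) {f : Ω → ℝ} (hf : f ∈ lipBall Ω) :
    ∫ z, f z ∂(p : Measure Ω) - ∑ i, ((cellCount cell x i : ℝ) + l i) / n * f (y i) ≤
      dBL (p : Measure Ω).toSignedMeasure (noisyMeasure cell y x l) := by
  have hb : BddAbove (Set.range fun g : lipBall Ω =>
      (∫ᵛ z, (g : Ω → ℝ) z ∂<•(p : Measure Ω).toSignedMeasure) -
        ∫ᵛ z, (g : Ω → ℝ) z ∂<•noisyMeasure cell y x l) := by
    refine ⟨Metric.diam (Set.univ : Set Ω) +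
      ∑ i, |((cellCount cell x i : ℝ) + l i) / n| * Metric.diam (Set.univ : Set Ω), ?_⟩
    rintro _ ⟨⟨g, hg⟩, rfl⟩
    simp only [integral_noisyMeasure, VectorMeasure.integral_toSignedMeasure]
    rw [sub_eq_add_neg, ← Finset.sum_neg_distrib]
    refine add_le_add ?_ (Finset.sum_le_sum fun i _ => ?_)
    · have := norm_integral_le_of_norm_le_const (μ := (p : Measure Ω))
        (Filter.Eventually.of_forall fun z => (Real.norm_eq_abs (g z)).trans_le (hg.2 z))
      rw [probReal_univ, mul_one] at this
      exact (le_abs_self _).trans this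
    · refine (neg_le_abs _).trans ?_
      rw [abs_mul]
      exact mul_le_mul_of_nonneg_left (hg.2 _) (abs_nonneg _)
  refine le_trans (le_of_eq ?_) (le_ciSup hb ⟨f, hf⟩)
  simp only [integral_noisyMeasure, VectorMeasure.integral_toSignedMeasure]

variable [BoundedSpace Ω]

theorem dBL_noisyMeasure_le [Nonempty Ω] (cell : Fin m → Set Ω) (y : Fin m → Ω) (x : Fin n → Ω)
    (l : Fin m → ℤ) (p : ProbabilityMeasure Ω) {D : ℝ}
    (h : ∀ f ∈ lipBall Ω, ∫ z, f z ∂(p : Measure Ω) -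
      ∑ i, ((cellCount cell x i : ℝ) + l i) / n * f (y i) ≤ D) :
    dBL (p : Measure Ω).toSignedMeasure (noisyMeasure cell y x l) ≤ D := by
  have : Nonempty (lipBall Ω) :=
    ⟨⟨_, sub_const_mem_lipBall (LipschitzWith.const (0 : ℝ) |>.weaken zero_le_one)
      (Classical.arbitrary Ω)⟩⟩
  refine ciSup_le fun f => ?_
  simp only [integral_noisyMeasure, VectorMeasure.integral_toSignedMeasure]
  exact h f f.2

/-- The transport error of the mechanism is at most the mesh of the partition plus twice the
uniform deviation of the noise over the bounded Lipschitz functions. -/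
theorem wasserstein_empirical_le (hn : 0 < n) {cell : Fin m → Set Ω} (hcell : IsPartition cell)
    {δ : ℝ} (hδ : ∀ i, Metric.diam (cell i) ≤ δ) {y : Fin m → Ω} (hy : ∀ i, y i ∈ cell i)
    (x : Fin n → Ω) (l : Fin m → ℤ) (p : ProbabilityMeasure Ω)
    (hp : IsClosestProbabilityOn (Set.range y) (noisyMeasure cell y x l) p) {D : ℝ}
    (hD : ∀ f ∈ lipBall Ω, (∑ i, (l i : ℝ) * f (y i)) / n ≤ D) :
    wasserstein (empirical x) (p : Measure Ω) ≤ ENNReal.ofReal (δ + 2 * D) := by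
  classical
  have hn' : (n : ℝ) ≠ 0 := by positivity
  have hex : ∀ j, ∃ i, x j ∈ cell i := fun j => by
    have : x j ∈ ⋃ i, cell i := by rw [hcell.2.2]; trivial
    simpa using this
  choose idx hidx using hex
  have huniq : ∀ j i, x j ∈ cell i → idx j = i := fun j i hji => by
    by_contra hne
    exact Set.disjoint_left.1 (hcell.2.1 hne) (hidx j) hji
  have hinj : Function.Injective y := fun i i' hii => by
    by_contra hne
    exact Set.disjoint_left.1 (hcell.2.1 hne) (hy i) (hii ▸ hy i')
  have hcount : ∀ i, (cellCount cell x i : ℝ) = ∑ j, if idx j = i then 1 else 0 := fun i => by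
    have : {j | x j ∈ cell i} = ((Finset.univ.filter fun j => idx j = i : Finset _) : Set _) := by
      ext j
      simp only [Set.mem_ofPred_eq, Finset.coe_filter, Finset.mem_univ, true_and]
      exact ⟨huniq j i, fun hj => hj ▸ hidx j⟩
    rw [cellCount, this, Set.ncard_coe_finset, Finset.sum_boole]
  -- Pairing with the noisy measure is pairing with the relocated data plus the noise term.
  have hsum : ∀ f : Ω → ℝ, ∑ i, ((cellCount cell x i : ℝ) + l i) / n * f (y i) =
      (n : ℝ)⁻¹ * ∑ j, f (y (idx j)) + (∑ i, (l i : ℝ) * f (y i)) / n := fun f => by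
    have e : ∑ j, f (y (idx j)) = ∑ i, (cellCount cell x i : ℝ) * f (y i) := by
      simp only [hcount, Finset.sum_mul]
      rw [Finset.sum_comm]
      simp
    rw [e, Finset.mul_sum, Finset.sum_div, ← Finset.sum_add_distrib]
    exact Finset.sum_congr rfl fun i _ => by ring
  have hx : Nonempty Ω := ⟨x ⟨0, hn⟩⟩
  let μY : ProbabilityMeasure Ω := ⟨empirical (y ∘ idx), isProbabilityMeasure_empirical hn _⟩
  have hμY : (μY : Measure Ω) (Set.range y)ᶜ = 0 := by
    have hm : MeasurableSet (Set.range y)ᶜ := (Set.finite_range y).measurableSet.compl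
    simp [μY, empirical, Measure.dirac_apply' _ hm]
  have hbest : dBL (p : Measure Ω).toSignedMeasure (noisyMeasure cell y x l) ≤ D := by
    refine (hp.2 μY hμY).trans (dBL_noisyMeasure_le _ _ _ _ _ fun f hf => ?_)
    have e : ∫ z, f z ∂(μY : Measure Ω) = (n : ℝ)⁻¹ * ∑ j, f (y (idx j)) :=
      integral_empirical _ _
    rw [e, hsum]
    have := hD _ (neg_mem_lipBall hf)
    simp only [mul_neg, Finset.sum_neg_distrib, neg_div] at this
    linarith
  have hpeq := eq_sum_smul_dirac_of_compl_range hinj (p : Measure Ω) hp.1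
  have hq1 : ∑ i, (p : Measure Ω).real {y i} = 1 := by
    have := integral_sum_ofReal_smul_dirac (y := y) (q := fun i => (p : Measure Ω).real {y i})
      (fun i => measureReal_nonneg) (fun _ => 1)
    rw [← hpeq] at this
    simpa using this.symm
  rw [hpeq, empirical_eq_sum_ofReal hn]
  refine wasserstein_le_of_forall_lipschitzWith x y _ _ _ (fun _ => by positivity)
    (by simp [hn']) (fun _ => measureReal_nonneg) hq1 fun f hf => ?_
  obtain ⟨z⟩ := hx
  set g : Ω → ℝ := fun w => f w - f z with hg
  have hgm : g ∈ lipBall Ω := sub_const_mem_lipBall hf z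
  have e1 : ∑ j, (n : ℝ)⁻¹ * f (x j) - ∑ i, (p : Measure Ω).real {y i} * f (y i) =
      (n : ℝ)⁻¹ * ∑ j, g (x j) - ∫ w, g w ∂(p : Measure Ω) := by
    rw [hpeq, integral_sum_ofReal_smul_dirac fun i => measureReal_nonneg, ← hpeq]
    simp only [hg, mul_sub, Finset.sum_sub_distrib, ← Finset.sum_mul, hq1, Finset.mul_sum]
    simp [hn']
  rw [e1]
  have h1 : (n : ℝ)⁻¹ * ∑ j, g (x j) ≤ (n : ℝ)⁻¹ * ∑ j, g (y (idx j)) + δ := by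
    have : ∑ j, g (x j) ≤ ∑ j, (g (y (idx j)) + δ) := Finset.sum_le_sum fun j _ => by
      have h2 := hgm.1.dist_le_mul (x j) (y (idx j))
      rw [Real.dist_eq, NNReal.coe_one, one_mul] at h2
      have h3 := Metric.dist_le_diam_of_mem (Bornology.IsBounded.all _) (hidx j) (hy (idx j))
      linarith [le_abs_self (g (x j) - g (y (idx j))), hδ (idx j)]
    calc (n : ℝ)⁻¹ * ∑ j, g (x j) ≤ (n : ℝ)⁻¹ * ∑ j, (g (y (idx j)) + δ) :=
          mul_le_mul_of_nonneg_left this (by positivity)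
      _ = _ := by
          rw [Finset.sum_add_distrib, mul_add]
          simp [hn']
  -- The test function is `-g`. One D comes from the closeness of p to the noisy measure, the other
  -- from the noise in that measure.
  have h4 := (le_dBL_noisyMeasure cell y x l p (neg_mem_lipBall hgm)).trans hbest
  have h5 := hD _ (neg_mem_lipBall hgm)
  have h6 := hsum g
  simp only [mul_neg, Finset.sum_neg_distrib, neg_div, integral_neg] at h4 h5
  linarith

end Mechanism

/-! ### Chaining along dyadic grids -/

section DyadicGrid

/-- The index `⌈2 ^ k z⌉ - 1` of the dyadic interval of length `2 ^ (-k)` containing `z`. -/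
noncomputable def dyadicIndex (k : ℕ) (z : ℝ) : ℕ := ⌈2 ^ k * z⌉₊ - 1

/-- Half-open intervals closed on the right put z = 1 in the last cell; truncated subtraction puts z
= 0 in the first. -/
theorem dyadicIndex_lt {k : ℕ} {z : ℝ} (hz : z ≤ 1) : dyadicIndex k z < 2 ^ k := by
  have h : ⌈2 ^ k * z⌉₊ ≤ 2 ^ k := Nat.ceil_le.2 (by
    push_cast
    exact mul_le_of_le_one_right (by positivity) hz)
  have := Nat.two_pow_pos k
  rw [dyadicIndex]
  omega

/-- The grids are nested: for w > 0, `⌈2w⌉` is `2⌈w⌉ - 1` or `2⌈w⌉`, and both halve to `⌈w⌉ - 1`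
after the shift. -/
theorem dyadicIndex_succ_div_two (k : ℕ) (z : ℝ) :
    dyadicIndex (k + 1) z / 2 = dyadicIndex k z := by
  have e : (2 : ℝ) ^ (k + 1) * z = 2 * (2 ^ k * z) := by ring
  rw [dyadicIndex, dyadicIndex, e]
  set w : ℝ := 2 ^ k * z
  have h1 : ⌈2 * w⌉₊ ≤ 2 * ⌈w⌉₊ := Nat.ceil_le.2 (by
    push_cast
    linarith [Nat.le_ceil w])
  rcases Nat.eq_zero_or_pos ⌈w⌉₊ with h0 | h0
  · omega
  · have h2 : ((⌈w⌉₊ - 1 : ℕ) : ℝ) < w := Nat.lt_ceil.1 (by omega)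
    have h3 : 2 * (⌈w⌉₊ - 1) < ⌈2 * w⌉₊ := Nat.lt_ceil.2 (by
      push_cast
      linarith)
    omega

theorem abs_sub_dyadicIndex_le {z : ℝ} (k : ℕ) (hz : 0 ≤ z) :
    |z - dyadicIndex k z / 2 ^ k| ≤ (1 / 2) ^ k := by
  have hk : (0 : ℝ) < 2 ^ k := by positivity
  have e : z - dyadicIndex k z / 2 ^ k = (2 ^ k * z - dyadicIndex k z) * (1 / 2) ^ k := by
    rw [one_div, inv_pow]
    field_simp
  rw [e, abs_mul, abs_of_pos (by positivity : (0 : ℝ) < (1 / 2) ^ k)]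
  refine mul_le_of_le_one_left (by positivity) ?_
  rw [dyadicIndex]
  set w : ℝ := 2 ^ k * z with hw
  have hw0 : 0 ≤ w := by positivity
  rcases Nat.eq_zero_or_pos ⌈w⌉₊ with h0 | h0
  · have : w ≤ 0 := Nat.ceil_eq_zero.1 h0
    simp [le_antisymm this hw0]
  · have h1 := Nat.ceil_lt_add_one hw0
    have h2 := Nat.le_ceil w
    rw [Nat.cast_sub h0, Nat.cast_one, abs_le]
    constructor <;> linarith

variable {d : ℕ}

/-- The dyadic cell of side `2 ^ (-k)` containing a point of the cube. -/
noncomputable def gridCell (k : ℕ) (z : Cube d) : Fin d → Fin (2 ^ k) :=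
  fun t => ⟨dyadicIndex k (z t), dyadicIndex_lt (z t).2.2⟩

/-- The lower corner of a dyadic cell. -/
noncomputable def gridCorner (k : ℕ) (Q : Fin d → Fin (2 ^ k)) : Cube d :=
  fun t => ⟨(Q t : ℝ) / 2 ^ k, by positivity, by
    rw [div_le_one (by positivity)]
    exact_mod_cast (Q t).2.le⟩

/-- The dyadic cell of the previous level containing a given dyadic cell. -/
def gridParent (k : ℕ) (Q : Fin d → Fin (2 ^ (k + 1))) : Fin d → Fin (2 ^ k) :=
  fun t => ⟨Q t / 2, by
    have := (Q t).2
    have e := pow_succ 2 k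
    omega⟩

theorem gridParent_gridCell (k : ℕ) (z : Cube d) :
    gridParent k (gridCell (k + 1) z) = gridCell k z := by
  ext t
  exact dyadicIndex_succ_div_two k (z t)

theorem dist_gridCorner_gridCell_le (k : ℕ) (z : Cube d) :
    dist z (gridCorner k (gridCell k z)) ≤ (1 / 2) ^ k := by
  rw [dist_pi_le_iff (by positivity)]
  intro t
  rw [Subtype.dist_eq, Real.dist_eq]
  exact abs_sub_dyadicIndex_le k (z t).2.1

/-- Each coordinate moves by the parity of the child index times `2^(-(k+1))`. -/
theorem dist_gridCorner_gridParent_le (k : ℕ) (Q : Fin d → Fin (2 ^ (k + 1))) :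
    dist (gridCorner (k + 1) Q) (gridCorner k (gridParent k Q)) ≤ (1 / 2) ^ (k + 1) := by
  rw [dist_pi_le_iff (by positivity)]
  intro t
  rw [Subtype.dist_eq, Real.dist_eq]
  simp only [gridCorner, gridParent]
  have e : ∀ u v : ℝ, u / 2 ^ (k + 1) - v / 2 ^ k = (u - 2 * v) * (1 / 2) ^ (k + 1) := by
    intro u v
    rw [one_div, inv_pow, pow_succ]
    field_simp
  rw [e, abs_mul, abs_of_pos (by positivity : (0 : ℝ) < (1 / 2) ^ (k + 1))]
  refine mul_le_of_le_one_left (by positivity) ?_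
  have h1 : 2 * ((Q t : ℕ) / 2) ≤ (Q t : ℕ) := by omega
  have h2 : (Q t : ℕ) ≤ 2 * ((Q t : ℕ) / 2) + 1 := by omega
  have h1' : 2 * (((Q t : ℕ) / 2 : ℕ) : ℝ) ≤ (Q t : ℕ) := by exact_mod_cast h1
  have h2' : ((Q t : ℕ) : ℝ) ≤ 2 * (((Q t : ℕ) / 2 : ℕ) : ℝ) + 1 := by exact_mod_cast h2
  rw [abs_le]
  constructor <;> linarith

theorem diam_univ_cube_le : Metric.diam (Set.univ : Set (Cube d)) ≤ 1 :=
  Metric.diam_le_of_forall_dist_le zero_le_one fun z _ w _ => by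
    rw [dist_pi_le_iff zero_le_one]
    exact fun t => Real.dist_le_of_mem_Icc_01 (z t).2 (w t).2

/-- The indices of the points lying in a given dyadic cell. -/
noncomputable def gridFiber {m : ℕ} (y : Fin m → Cube d) (k : ℕ) (Q : Fin d → Fin (2 ^ k)) :
    Finset (Fin m) :=
  Finset.univ.filter fun i => gridCell k (y i) = Q

theorem sum_mul_comp_gridCell {m : ℕ} (y : Fin m → Cube d) (l : Fin m → ℝ) (k : ℕ)
    (g : (Fin d → Fin (2 ^ k)) → ℝ) :
    ∑ i, l i * g (gridCell k (y i)) = ∑ Q, g Q * ∑ i ∈ gridFiber y k Q, l i := by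
  rw [← Finset.sum_fiberwise Finset.univ (fun i => gridCell k (y i))]
  refine Finset.sum_congr rfl fun Q _ => ?_
  rw [Finset.mul_sum]
  refine Finset.sum_congr rfl fun i hi => ?_
  rw [(Finset.mem_filter.1 hi).2, mul_comm]

/-- Multiscale bound for a weighted sum of values of a bounded Lipschitz function. -/
theorem sum_mul_le_sum_gridFiber {m : ℕ} (y : Fin m → Cube d) (l : Fin m → ℝ) {f : Cube d → ℝ}
    (hf : f ∈ lipBall (Cube d)) (K : ℕ) :
    ∑ i, l i * f (y i) ≤
      ∑ k ∈ Finset.range (K + 1), (1 / 2) ^ k * ∑ Q, |∑ i ∈ gridFiber y k Q, l i| +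
        (1 / 2) ^ K * ∑ i, |l i| := by
  have hlip : ∀ z w, |f z - f w| ≤ dist z w := fun z w => by
    simpa [Real.dist_eq] using hf.1.dist_le_mul z w
  have hgen : ∀ (k : ℕ) (g : (Fin d → Fin (2 ^ k)) → ℝ), (∀ Q, |g Q| ≤ (1 / 2) ^ k) →
      ∑ i, l i * g (gridCell k (y i)) ≤
        (1 / 2) ^ k * ∑ Q, |∑ i ∈ gridFiber y k Q, l i| := fun k g hg => by
    rw [sum_mul_comp_gridCell, Finset.mul_sum]
    refine Finset.sum_le_sum fun Q _ => (le_abs_self _).trans ?_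
    rw [abs_mul]
    exact mul_le_mul_of_nonneg_right (hg Q) (abs_nonneg _)
  have hgrid : ∀ k : ℕ, ∑ i, l i * f (gridCorner k (gridCell k (y i))) ≤
      ∑ k ∈ Finset.range (k + 1), (1 / 2) ^ k * ∑ Q, |∑ i ∈ gridFiber y k Q, l i| := by
    intro k
    induction k with
    | zero =>
      rw [Finset.sum_range_one]
      refine hgen 0 (fun Q => f (gridCorner 0 Q)) fun Q => ?_
      rw [pow_zero]
      -- Level 0 has no parent to subtract; here the sup bound on f is used.
      exact (hf.2 _).trans diam_univ_cube_le
    | succ k ih =>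
      rw [Finset.sum_range_succ]
      -- The chaining increment depends only on the finer cell, which determines its parent.
      have h := hgen (k + 1) (fun Q => f (gridCorner (k + 1) Q) - f (gridCorner k (gridParent k Q)))
        fun Q => (hlip _ _).trans (dist_gridCorner_gridParent_le k Q)
      simp only [gridParent_gridCell, mul_sub, Finset.sum_sub_distrib] at h
      linarith
  have hrest : ∑ i, l i * (f (y i) - f (gridCorner K (gridCell K (y i)))) ≤
      (1 / 2) ^ K * ∑ i, |l i| := by
    rw [Finset.mul_sum]
    refine Finset.sum_le_sum fun i _ => (le_abs_self _).trans ?_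
    rw [abs_mul, mul_comm]
    exact mul_le_mul_of_nonneg_right ((hlip _ _).trans (dist_gridCorner_gridCell_le K _))
      (abs_nonneg _)
  simp only [mul_sub, Finset.sum_sub_distrib] at hrest
  linarith [hgrid K]

theorem sum_card_gridFiber {m : ℕ} (y : Fin m → Cube d) (k : ℕ) :
    ∑ Q, (gridFiber y k Q).card = m := by
  simpa [gridFiber] using (Finset.card_eq_sum_card_fiberwise (s := Finset.univ) (t := Finset.univ)
    (f := fun i : Fin m => gridCell k (y i)) (fun _ _ => by simp)).symm

end DyadicGrid

/-! ### Moments of the discrete Laplace law -/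

section DiscreteLaplace

theorem hasSum_mul_succ_mul_geometric {p : ℝ} (hp0 : 0 ≤ p) (hp1 : p < 1) :
    HasSum (fun k : ℕ => ((k : ℝ) + 1) * (k + 2) * p ^ (k + 1)) (2 * p / (1 - p) ^ 3) := by
  have h := (hasSum_choose_mul_geometric_of_norm_lt_one (𝕜 := ℝ) 2 (r := p)
    (by rwa [Real.norm_of_nonneg hp0])).mul_left (2 * p)
  convert! h using 1
  · funext k
    have e : ((k + 2).choose 2 : ℝ) = ((k : ℝ) + 1) * (k + 2) / 2 := by
      rw [Nat.cast_choose_two]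
      push_cast
      ring
    rw [e]
    ring
  · ring

/-- With `p = exp (-1 / σ)`, the quantity `p / (1 - p) ^ 2` is at most `σ ^ 2`. -/
theorem exp_div_one_sub_exp_sq_le {σ : ℝ} (hσ : 0 < σ) :
    Real.exp (-1 / σ) / (1 - Real.exp (-1 / σ)) ^ 2 ≤ σ ^ 2 := by
  -- With `p = exp (-2t)` one has `√p / (1 - p) = 1 / (2 sinh t)`, and `t ≤ sinh t` bounds this by
  -- σ.
  set t : ℝ := 1 / (2 * σ) with ht
  have ht0 : 0 < t := by positivity
  have hs := Real.self_le_sinh_iff.2 ht0.le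
  rw [Real.sinh_eq] at hs
  set h := Real.exp (-t) with hh
  have h0 : 0 < h := Real.exp_pos _
  have h1 : h < 1 := Real.exp_lt_one_iff.2 (by linarith)
  have e1 : Real.exp (-1 / σ) = h ^ 2 := by
    rw [hh, ← Real.exp_nat_mul]
    congr 1
    rw [ht]
    field_simp
    norm_num
  have e2 : Real.exp t * h = 1 := by rw [hh, ← Real.exp_add, add_neg_cancel, Real.exp_zero]
  have e3 : 2 * t * σ = 1 := by rw [ht]; field_simp
  rw [e1, div_le_iff₀ (by nlinarith [mul_pos (sub_pos.2 h1) (by linarith : 0 < 1 + h)]), ← mul_pow]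
  refine pow_le_pow_left₀ h0.le ?_ 2
  have h2 : 2 * t * h ≤ 1 - h ^ 2 := by
    nlinarith [mul_le_mul_of_nonneg_right hs h0.le]
  calc h = 2 * t * h * σ := by linear_combination (-h) * e3
    _ ≤ (1 - h ^ 2) * σ := mul_le_mul_of_nonneg_right h2 hσ.le
    _ = σ * (1 - h ^ 2) := mul_comm _ _

/-- Replacing `z²` by `|z|(|z|+1)` gives each half-line the closed-form sum `2p/(1-p)³`. -/
theorem lintegral_sq_discreteLaplace_le {σ : ℝ} (hσ : 0 < σ) :
    ∫⁻ z : ℤ, ENNReal.ofReal ((z : ℝ) ^ 2) ∂discreteLaplace σ ≤ ENNReal.ofReal (4 * σ ^ 2) := by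
  have hbound := exp_div_one_sub_exp_sq_le hσ
  have hkey : ∀ k : ℕ, Real.exp (-(k : ℝ) / σ) = Real.exp (-1 / σ) ^ k := by
    intro k
    rw [← Real.exp_nat_mul]
    congr 1
    ring
  set p := Real.exp (-1 / σ) with hp
  have hp0 : 0 < p := Real.exp_pos _
  have hp1 : p < 1 := Real.exp_lt_one_iff.2 (div_neg_of_neg_of_pos (by norm_num) hσ)
  have hp1' : 0 < 1 - p := by linarith
  have h2 := hasSum_mul_succ_mul_geometric hp0.le hp1
  have h1 : HasSum (fun k : ℕ => (k : ℝ) * (k + 1) * p ^ k) (2 * p / (1 - p) ^ 3) := by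
    rw [← hasSum_nat_add_iff' 1]
    convert! h2 using 1
    · funext k
      push_cast
      ring
    · simp
  have h3 := (HasSum.of_nat_of_neg_add_one
    (f := fun z : ℤ => |(z : ℝ)| * (|(z : ℝ)| + 1) * Real.exp (-|(z : ℝ)| / σ))
    (m := 2 * p / (1 - p) ^ 3) (m' := 2 * p / (1 - p) ^ 3)
    (by
      convert! h1 using 2 with k
      rw [Int.cast_natCast, Nat.abs_cast, hkey])
    (by
      convert! h2 using 2 with k
      have e' : |((-((k : ℤ) + 1) : ℤ) : ℝ)| = ((k + 1 : ℕ) : ℝ) := by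
        push_cast
        rw [abs_neg, abs_of_nonneg (by positivity)]
      rw [e', hkey]
      push_cast
      ring)).mul_left ((1 - p) / (1 + p))
  have hw : ∀ z : ℤ, 0 ≤ (1 - p) / (1 + p) * Real.exp (-|(z : ℝ)| / σ) := fun z => by positivity
  rw [discreteLaplace, lintegral_sum_measure]
  simp only [lintegral_smul_measure, lintegral_dirac, smul_eq_mul]
  calc _ ≤ ∑' z : ℤ, ENNReal.ofReal ((1 - p) / (1 + p) *
        (|(z : ℝ)| * (|(z : ℝ)| + 1) * Real.exp (-|(z : ℝ)| / σ))) := by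
        refine ENNReal.tsum_le_tsum fun z => ?_
        rw [← ENNReal.ofReal_mul (hw z)]
        refine ENNReal.ofReal_le_ofReal ?_
        have : (z : ℝ) ^ 2 ≤ |(z : ℝ)| * (|(z : ℝ)| + 1) := by
          rw [← sq_abs]
          nlinarith [abs_nonneg (z : ℝ)]
        calc _ ≤ (1 - p) / (1 + p) * Real.exp (-|(z : ℝ)| / σ) *
              (|(z : ℝ)| * (|(z : ℝ)| + 1)) := mul_le_mul_of_nonneg_left this (hw z)
          _ = _ := by ring
    _ = ENNReal.ofReal ((1 - p) / (1 + p) * (2 * p / (1 - p) ^ 3 + 2 * p / (1 - p) ^ 3)) := by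
        rw [← ENNReal.ofReal_tsum_of_nonneg (fun z => by positivity) h3.summable, h3.tsum_eq]
    _ ≤ _ := by
        refine ENNReal.ofReal_le_ofReal ?_
        have e : (1 - p) / (1 + p) * (2 * p / (1 - p) ^ 3 + 2 * p / (1 - p) ^ 3) =
            4 * (p / (1 - p) ^ 2) / (1 + p) := by
          field_simp
          ring
        rw [e]
        refine (div_le_self (by positivity) (by linarith)).trans ?_
        linarith

theorem memLp_two_intCast_discreteLaplace {σ : ℝ} (hσ : 0 < σ) :
    MemLp (fun z : ℤ => (z : ℝ)) 2 (discreteLaplace σ) := by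
  rw [memLp_two_iff_integrable_sq (by fun_prop)]
  refine ⟨by fun_prop, ?_⟩
  rw [hasFiniteIntegral_iff_ofReal (Filter.Eventually.of_forall fun z => sq_nonneg _)]
  exact (lintegral_sq_discreteLaplace_le hσ).trans_lt ENNReal.ofReal_lt_top

theorem integral_sq_discreteLaplace_le {σ : ℝ} (hσ : 0 < σ) :
    ∫ z : ℤ, (z : ℝ) ^ 2 ∂discreteLaplace σ ≤ 4 * σ ^ 2 := by
  rw [integral_eq_lintegral_of_nonneg_ae (Filter.Eventually.of_forall fun z => sq_nonneg _)
    (by fun_prop)]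
  exact ENNReal.toReal_le_of_le_ofReal (by positivity) (lintegral_sq_discreteLaplace_le hσ)

theorem map_neg_discreteLaplace (σ : ℝ) :
    (discreteLaplace σ).map (fun z => -z) = discreteLaplace σ := by
  rw [discreteLaplace, Measure.map_sum (by fun_prop)]
  ext s hs
  rw [Measure.sum_apply _ hs, Measure.sum_apply _ hs, ← (Equiv.neg ℤ).tsum_eq]
  refine tsum_congr fun z => ?_
  rw [Measure.map_smul, Measure.map_dirac' (by fun_prop)]
  simp

theorem integral_intCast_discreteLaplace (σ : ℝ) :
    ∫ z : ℤ, (z : ℝ) ∂discreteLaplace σ = 0 := by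
  have h := integral_map (μ := discreteLaplace σ) (φ := fun z : ℤ => -z)
    (f := fun z : ℤ => (z : ℝ)) (by fun_prop) (by fun_prop)
  rw [map_neg_discreteLaplace] at h
  simp only [Int.cast_neg, integral_neg] at h
  linarith

end DiscreteLaplace

/-! ### Second moments and block sums -/

section Moments

variable {S : Type*} [MeasurableSpace S] {P : Measure S} [IsProbabilityMeasure P]
  {ι : Type*} {X : ι → S → ℝ} {v : ℝ}

/-- Centring turns second moments into variances, which add under pairwise independence. -/
theorem integral_sq_sum_le (hX : ∀ i, MemLp (X i) 2 P) (h0 : ∀ i, ∫ s, X i s ∂P = 0)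
    (hv : ∀ i, ∫ s, X i s ^ 2 ∂P ≤ v ^ 2) (hind : Pairwise fun i j => X i ⟂ᵢ[P] X j)
    (A : Finset ι) :
    ∫ s, (∑ i ∈ A, X i s) ^ 2 ∂P ≤ v ^ 2 * A.card := by
  have hint : ∫ s, (∑ i ∈ A, X i) s ∂P = 0 := by
    simp only [Finset.sum_apply]
    rw [integral_finsetSum _ fun i _ => (hX i).integrable (by norm_num)]
    simp [h0]
  have h := variance_eq_sub (memLp_finsetSum' A fun i _ => hX i)
  rw [hint, IndepFun.variance_sum (fun i _ => hX i) fun i _ j _ hij => hind hij] at h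
  have e : ∫ s, ((∑ i ∈ A, X i) ^ 2) s ∂P = ∫ s, (∑ i ∈ A, X i s) ^ 2 ∂P := by simp
  rw [e] at h
  have h2 : ∑ i ∈ A, Var[X i; P] ≤ ∑ i ∈ A, v ^ 2 := Finset.sum_le_sum fun i _ => by
    rw [variance_eq_sub (hX i), h0]
    simpa using hv i
  rw [Finset.sum_const, nsmul_eq_mul] at h2
  linarith

/-- The expected `ℓ¹`-norm of the sums of centred independent variables over the blocks of a
partition. -/
theorem integral_sum_abs_sum_le {m : ℕ} (hm : 0 < m) {κ : Type*} [Fintype κ] [Nonempty κ]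
    (hX : ∀ i, MemLp (X i) 2 P) (h0 : ∀ i, ∫ s, X i s ∂P = 0) (hv0 : 0 < v)
    (hv : ∀ i, ∫ s, X i s ^ 2 ∂P ≤ v ^ 2) (hind : Pairwise fun i j => X i ⟂ᵢ[P] X j)
    (A : κ → Finset ι) (hA : ∑ Q, (A Q).card = m) :
    ∫ s, ∑ Q, |∑ i ∈ A Q, X i s| ∂P ≤ v * √((Fintype.card κ : ℝ) * m) := by
  have hmem : ∀ Q, MemLp (fun s => ∑ i ∈ A Q, X i s) 2 P := fun Q =>
    memLp_finsetSum _ fun i _ => hX i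
  have hN : (0 : ℝ) < Fintype.card κ := by exact_mod_cast Fintype.card_pos
  have hm' : (0 : ℝ) < m := by exact_mod_cast hm
  set N : ℝ := (Fintype.card κ : ℝ) with hNdef
  set r := √(N * m) with hr
  have hr0 : 0 < r := Real.sqrt_pos.2 (by positivity)
  have hr2 : r ^ 2 = N * m := Real.sq_sqrt (by positivity)
  -- This t minimises `t v² m / 2 + N / (2t)`, the total of the bounds `|w| ≤ t w²/2 + 1/(2t)` over
  -- N blocks; the minimum is `v √(N m)`.
  set t : ℝ := r / (v * m) with ht
  have ht0 : 0 < t := by positivity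
  rw [integral_finsetSum _ fun Q _ => ((hmem Q).integrable (by norm_num)).abs]
  have hQ : ∀ Q, ∫ s, |∑ i ∈ A Q, X i s| ∂P ≤ t / 2 * (v ^ 2 * (A Q).card) + 1 / (2 * t) := by
    intro Q
    have hsq : Integrable (fun s => (∑ i ∈ A Q, X i s) ^ 2) P := (hmem Q).integrable_sq
    calc ∫ s, |∑ i ∈ A Q, X i s| ∂P
        ≤ ∫ s, (t / 2 * (∑ i ∈ A Q, X i s) ^ 2 + 1 / (2 * t)) ∂P := by
          refine integral_mono ((hmem Q).integrable (by norm_num)).abs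
            ((hsq.const_mul _).add (integrable_const _)) fun s => ?_
          show |∑ i ∈ A Q, X i s| ≤ t / 2 * (∑ i ∈ A Q, X i s) ^ 2 + 1 / (2 * t)
          rw [← sq_abs (∑ i ∈ A Q, X i s)]
          set w := |∑ i ∈ A Q, X i s|
          have : t / 2 * w ^ 2 + 1 / (2 * t) - w = (t * w - 1) ^ 2 / (2 * t) := by
            field_simp
            ring
          have h2 : 0 ≤ (t * w - 1) ^ 2 / (2 * t) := by positivity
          linarith
      _ = t / 2 * ∫ s, (∑ i ∈ A Q, X i s) ^ 2 ∂P + 1 / (2 * t) := by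
          rw [integral_add (hsq.const_mul _) (integrable_const _), integral_const_mul]
          simp
      _ ≤ _ := by
          gcongr
          exact integral_sq_sum_le hX h0 hv hind _
  refine (Finset.sum_le_sum fun Q _ => hQ Q).trans (le_of_eq ?_)
  rw [Finset.sum_add_distrib, ← Finset.mul_sum, ← Finset.mul_sum, ← Nat.cast_sum, hA,
    Finset.sum_const, nsmul_eq_mul, Finset.card_univ, ← hNdef]
  have e : N = r ^ 2 / m := by rw [hr2]; field_simp
  rw [e, ht]
  field_simp
  ring

end Moments

/-! ### Expected error at a fixed finest level -/

section Error

variable {d n m : ℕ}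

/-- The product coupling suffices; this handles εn < 1. -/
theorem wasserstein_cube_le_one (μ ν : Measure (Cube d)) [IsProbabilityMeasure μ]
    [IsProbabilityMeasure ν] : wasserstein μ ν ≤ 1 := by
  refine iInf₂_le_of_le (μ.prod ν) ⟨Measure.fst_prod, Measure.snd_prod⟩ ?_
  calc ∫⁻ p, edist p.1 p.2 ∂μ.prod ν ≤ ∫⁻ _, 1 ∂μ.prod ν := lintegral_mono fun p => by
        rw [edist_dist, ENNReal.ofReal_le_one]
        exact (Metric.dist_le_diam_of_mem (Bornology.IsBounded.all _) (Set.mem_univ _)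
          (Set.mem_univ _)).trans diam_univ_cube_le
    _ = 1 := by simp

/-- The expected error of the mechanism, for every choice of the finest dyadic level `K`. -/
theorem lintegral_wasserstein_le (hn : 0 < n) (hm : 0 < m) {ε : ℝ} (hε : 0 < ε)
    {cell : Fin m → Set (Cube d)} (hcell : IsPartition cell) {δ : ℝ} (hδ0 : 0 ≤ δ)
    (hδ : ∀ i, Metric.diam (cell i) ≤ δ) {y : Fin m → Cube d} (hy : ∀ i, y i ∈ cell i)
    (x : Fin n → Cube d) {S : Type*} [MeasurableSpace S] (P : Measure S) [IsProbabilityMeasure P]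
    (νhat : S → ProbabilityMeasure (Cube d)) (hout : IsOutput P ε cell y x νhat) (K : ℕ) :
    ∫⁻ s, wasserstein (empirical x) (νhat s : Measure (Cube d)) ∂P ≤
      ENNReal.ofReal (δ + 4 / (ε * n) *
        (∑ k ∈ Finset.range (K + 1), (1 / 2) ^ k * √((2 ^ k) ^ d * m) + (1 / 2) ^ K * m)) := by
  obtain ⟨-, lam, hlaw, hindep, hclosest⟩ := hout
  have hσ : 0 < 1 / ε := by positivity
  set X : Fin m → S → ℝ := fun i s => (lam i s : ℝ) with hXdef
  have hX : ∀ i, MemLp (X i) 2 P := fun i => by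
    have h := memLp_two_intCast_discreteLaplace hσ
    rw [← (hlaw i).map_eq] at h
    exact h.comp_of_map (hlaw i).aemeasurable
  have h0 : ∀ i, ∫ s, X i s ∂P = 0 := fun i =>
    ((hlaw i).integral_comp (f := fun z : ℤ => (z : ℝ)) (by fun_prop)).trans
      (integral_intCast_discreteLaplace _)
  have hv : ∀ i, ∫ s, X i s ^ 2 ∂P ≤ (2 / ε) ^ 2 := fun i => by
    refine (((hlaw i).integral_comp (f := fun z : ℤ => (z : ℝ) ^ 2) (by fun_prop)).trans_le
      (integral_sq_discreteLaplace_le hσ)).trans (le_of_eq ?_)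
    ring
  have hind : Pairwise fun i j => X i ⟂ᵢ[P] X j := fun i j hij =>
    (hindep.indepFun hij).comp (φ := fun z : ℤ => (z : ℝ)) (ψ := fun z : ℤ => (z : ℝ))
      (by fun_prop) (by fun_prop)
  have hXint : ∀ i, Integrable (X i) P := fun i => (hX i).integrable (by norm_num)
  set G : ℕ → S → ℝ := fun k s => ∑ Q, |∑ i ∈ gridFiber y k Q, X i s| with hG
  have hGint : ∀ k, Integrable (G k) P := fun k =>
    integrable_finsetSum _ fun Q _ => (integrable_finsetSum _ fun i _ => hXint i).abs
  have hGle : ∀ k, ∫ s, G k s ∂P ≤ 2 / ε * √((2 ^ k) ^ d * m) := fun k => by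
    have := integral_sum_abs_sum_le hm hX h0 (by positivity) hv hind (gridFiber y k)
      (sum_card_gridFiber y k)
    simpa using this
  set H : S → ℝ := fun s => ∑ i, |X i s| with hH
  have hHint : Integrable H P := integrable_finsetSum _ fun i _ => (hXint i).abs
  have hHle : ∫ s, H s ∂P ≤ 2 / ε * m := by
    have : Nonempty (Fin m) := ⟨⟨0, hm⟩⟩
    -- Singleton blocks: there are m of them, so the square root is m.
    have := integral_sum_abs_sum_le hm hX h0 (by positivity) hv hind (fun i : Fin m => {i})
      (by simp)
    simpa using this
  set R : S → ℝ := fun s =>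
    δ + 2 / n * (∑ k ∈ Finset.range (K + 1), (1 / 2) ^ k * G k s + (1 / 2) ^ K * H s) with hR
  have hsum : Integrable (fun s => ∑ k ∈ Finset.range (K + 1), (1 / 2) ^ k * G k s) P :=
    integrable_finsetSum _ fun k _ => (hGint k).const_mul _
  have hadd : Integrable (fun s => ∑ k ∈ Finset.range (K + 1), (1 / 2) ^ k * G k s +
      (1 / 2) ^ K * H s) P := hsum.add (hHint.const_mul _)
  have hRint : Integrable R P := (integrable_const δ).add (hadd.const_mul _)
  have hRval : ∫ s, R s ∂P = δ + 2 / n * (∑ k ∈ Finset.range (K + 1),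
      (1 / 2) ^ k * ∫ s, G k s ∂P + (1 / 2) ^ K * ∫ s, H s ∂P) := by
    simp only [hR]
    rw [integral_add (integrable_const δ) (hadd.const_mul _), integral_const_mul,
      integral_add hsum (hHint.const_mul _), integral_const_mul,
      integral_finsetSum _ fun k _ => (hGint k).const_mul _]
    simp only [integral_const_mul, integral_const, probReal_univ, one_smul]
  have hR0 : ∀ s, 0 ≤ R s := fun s => by
    have h1 : ∀ k, 0 ≤ G k s := fun k => Finset.sum_nonneg fun _ _ => abs_nonneg _
    have h2 : 0 ≤ H s := Finset.sum_nonneg fun _ _ => abs_nonneg _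
    have h3 : 0 ≤ ∑ k ∈ Finset.range (K + 1), (1 / 2) ^ k * G k s :=
      Finset.sum_nonneg fun k _ => mul_nonneg (by positivity) (h1 k)
    positivity
  calc ∫⁻ s, wasserstein (empirical x) (νhat s : Measure (Cube d)) ∂P
      ≤ ∫⁻ s, ENNReal.ofReal (R s) ∂P := by
        refine lintegral_mono_ae ?_
        filter_upwards [hclosest] with s hs
        refine (wasserstein_empirical_le hn hcell hδ hy x _ _ hs
          (D := (∑ k ∈ Finset.range (K + 1), (1 / 2) ^ k * G k s + (1 / 2) ^ K * H s) / n)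
          fun f hf => ?_).trans (le_of_eq ?_)
        · exact div_le_div_of_nonneg_right (sum_mul_le_sum_gridFiber y (fun i => X i s) hf K)
            (by positivity)
        · rw [hR]
          congr 1
          ring
    _ = ENNReal.ofReal (∫ s, R s ∂P) :=
        (ofReal_integral_eq_lintegral_ofReal hRint (Filter.Eventually.of_forall hR0)).symm
    _ ≤ _ := by
        refine ENNReal.ofReal_le_ofReal ?_
        rw [hRval]
        have e : 4 / (ε * n) * (∑ k ∈ Finset.range (K + 1), (1 / 2) ^ k * √((2 ^ k) ^ d * m) +
            (1 / 2) ^ K * m) = 2 / n * (∑ k ∈ Finset.range (K + 1), (1 / 2) ^ k *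
              (2 / ε * √((2 ^ k) ^ d * m)) + (1 / 2) ^ K * (2 / ε * m)) := by
          simp only [mul_left_comm _ (2 / ε) _, ← Finset.mul_sum, ← mul_add]
          rw [← mul_assoc]
          congr 1
          field_simp
          norm_num
        rw [e]
        gcongr with k hk
        exact hGle k

end Error

/-! ### Choice of the finest scale -/

section Scales

/-- Exhibits the level costs as a geometric progression of ratio `2^(d/2-1)`, the source of the
three regimes. -/
theorem half_pow_mul_sqrt (d k : ℕ) (M : ℝ) :
    (1 / 2) ^ k * √((2 ^ k) ^ d * M) = √M * (√(2 ^ d) / 2) ^ k := by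
  have h : √(((2 : ℝ) ^ d) ^ k) = √(2 ^ d) ^ k := by
    rw [← Real.sqrt_sq (pow_nonneg (Real.sqrt_nonneg (2 ^ d)) k)]
    congr 1
    rw [← pow_mul (√(2 ^ d)), mul_comm k 2, pow_mul (√(2 ^ d)), Real.sq_sqrt (by positivity)]
  rw [← pow_mul, mul_comm k d, pow_mul, Real.sqrt_mul (by positivity), h, div_pow, div_pow, one_pow]
  ring

theorem rpow_neg_one_div_two (M : ℝ) (hM : 0 ≤ M) : M ^ (-(1 : ℝ) / 2) = (√M)⁻¹ := by
  rw [neg_div, Real.rpow_neg hM, Real.sqrt_eq_rpow]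

theorem div_mul_sqrt (c : ℝ) {M : ℝ} (hM : 0 < M) : c / M * √M = c * M ^ (-(1 : ℝ) / 2) := by
  rw [rpow_neg_one_div_two M hM.le]
  have h := Real.sq_sqrt hM.le
  have : √M ≠ 0 := (Real.sqrt_pos.2 hM).ne'
  field_simp
  linear_combination c * h

/-- Optimization over the finest level in dimension one. -/
theorem exists_level_dim_one {m : ℕ} (hm : 0 < m) : ∃ K : ℕ,
    8 / (m : ℝ) * (∑ k ∈ Finset.range (K + 1), (1 / 2) ^ k * √((2 ^ k) ^ 1 * (m : ℝ)) +
      (1 / 2) ^ K * m) ≤ 80 * (m : ℝ) ^ (-(1 : ℝ) / 2) := by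
  have hm1 : (1 : ℝ) ≤ m := by exact_mod_cast hm
  -- The series converges, so K need only make the remainder small; `m ≤ 2^m` suffices.
  refine ⟨m, ?_⟩
  simp only [half_pow_mul_sqrt, ← Finset.mul_sum]
  set q : ℝ := √(2 ^ 1) / 2 with hq
  have hq0 : 0 ≤ q := by positivity
  have hq1 : q ≤ 3 / 4 := by
    have : √(2 ^ 1) ≤ 3 / 2 := Real.sqrt_le_iff.2 (by norm_num)
    rw [hq]
    linarith
  have hgeom : ∑ k ∈ Finset.range (m + 1), q ^ k ≤ 4 := by
    refine (Summable.sum_le_tsum _ (fun k _ => by positivity)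
      (summable_geometric_of_lt_one hq0 (by linarith))).trans ?_
    rw [tsum_geometric_of_lt_one hq0 (by linarith), inv_le_comm₀ (by linarith) (by norm_num)]
    linarith
  have hs : 1 ≤ √(m : ℝ) := Real.one_le_sqrt.2 hm1
  have hrest : (1 / 2 : ℝ) ^ m * m ≤ 1 := by
    have : (m : ℝ) ≤ 2 ^ m := by exact_mod_cast Nat.lt_two_pow_self.le
    rw [one_div, inv_pow, inv_mul_le_iff₀ (by positivity)]
    linarith
  calc _ ≤ 8 / (m : ℝ) * (10 * √(m : ℝ)) := by
        refine mul_le_mul_of_nonneg_left ?_ (by positivity)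
        nlinarith [mul_le_mul_of_nonneg_left hgeom (by linarith : 0 ≤ √(m : ℝ))]
    _ = _ := by
        rw [← div_mul_sqrt 80 (by linarith)]
        ring

/-- Optimization over the finest level in dimension two. -/
theorem exists_level_dim_two {m : ℕ} (hm : 0 < m) : ∃ K : ℕ,
    8 / (m : ℝ) * (∑ k ∈ Finset.range (K + 1), (1 / 2) ^ k * √((2 ^ k) ^ 2 * (m : ℝ)) +
      (1 / 2) ^ K * m) ≤ 8 * (Real.log m / Real.log 2 + 3) * (m : ℝ) ^ (-(1 : ℝ) / 2) := by
  have hm1 : (1 : ℝ) ≤ m := by exact_mod_cast hm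
  -- Now `2^K ≤ m < 2^(K+1)`: about `log₂ m` levels, each costing `√m`, and a remainder of at most
  -- 2.
  obtain ⟨K, hK1, hK2⟩ := exists_nat_pow_near hm1 (by norm_num : (1 : ℝ) < 2)
  refine ⟨K, ?_⟩
  simp only [half_pow_mul_sqrt, ← Finset.mul_sum]
  have hq : √((2 : ℝ) ^ 2) / 2 = 1 := by
    rw [Real.sqrt_sq (by norm_num)]
    norm_num
  have hs : 1 ≤ √(m : ℝ) := Real.one_le_sqrt.2 hm1
  have hrest : (1 / 2 : ℝ) ^ K * m ≤ 2 := by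
    rw [one_div, inv_pow, inv_mul_le_iff₀ (by positivity)]
    linarith [pow_succ (2 : ℝ) K]
  have hlog2 : 0 < Real.log 2 := Real.log_pos (by norm_num)
  have hK3 : (K : ℝ) ≤ Real.log m / Real.log 2 := by
    rw [le_div_iff₀ hlog2, ← Real.log_pow]
    exact Real.log_le_log (by positivity) hK1
  simp only [hq, one_pow, Finset.sum_const, Finset.card_range, nsmul_eq_mul, mul_one]
  push_cast
  calc _ ≤ 8 / (m : ℝ) * ((Real.log m / Real.log 2 + 3) * √(m : ℝ)) := by
        refine mul_le_mul_of_nonneg_left ?_ (by positivity)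
        nlinarith [mul_le_mul_of_nonneg_left hK3 (by linarith : 0 ≤ √(m : ℝ))]
    _ = _ := by
        rw [← div_mul_sqrt _ (by linarith)]
        ring

/-- Optimization over the finest level in dimension at least three. -/
theorem exists_level_of_three_le {d m : ℕ} (hd : 3 ≤ d) (hm : 0 < m) : ∃ K : ℕ,
    8 / (m : ℝ) * (∑ k ∈ Finset.range (K + 1), (1 / 2) ^ k * √((2 ^ k) ^ d * (m : ℝ)) +
      (1 / 2) ^ K * m) ≤ 80 * (m : ℝ) ^ (-(1 : ℝ) / d) := by
  have hm1 : (1 : ℝ) ≤ m := by exact_mod_cast hm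
  have hd0 : d ≠ 0 := by omega
  set r : ℝ := (m : ℝ) ^ (1 / (d : ℝ)) with hr
  have hr1 : 1 ≤ r := Real.one_le_rpow hm1 (by positivity)
  have hrd : r ^ d = m := by
    rw [hr, one_div, Real.rpow_inv_natCast_pow (by linarith) hd0]
  obtain ⟨K, hK1, hK2⟩ := exists_nat_pow_near hr1 (by norm_num : (1 : ℝ) < 2)
  refine ⟨K, ?_⟩
  have hhalf : (1 / 2 : ℝ) ^ K ≤ 2 * (m : ℝ) ^ (-(1 : ℝ) / d) := by
    rw [neg_div, Real.rpow_neg (by linarith), ← hr, one_div, inv_pow, ← div_eq_mul_inv,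
      inv_le_comm₀ (by positivity) (by positivity), inv_div]
    linarith [pow_succ (2 : ℝ) K]
  -- Since `2^(Kd) ≤ m`, the finest level costs no more than the remainder, and the growing
  -- geometric sum is at most 4 times its last term.
  have hlast : √(m : ℝ) * (√(2 ^ d) / 2) ^ K ≤ (1 / 2) ^ K * m := by
    rw [← half_pow_mul_sqrt]
    refine mul_le_mul_of_nonneg_left (Real.sqrt_le_iff.2 ⟨by linarith, ?_⟩) (by positivity)
    have : ((2 : ℝ) ^ K) ^ d ≤ m := hrd ▸ pow_le_pow_left₀ (by positivity) hK1 d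
    nlinarith
  simp only [half_pow_mul_sqrt, ← Finset.mul_sum]
  set q : ℝ := √(2 ^ d) / 2 with hq
  have hq1 : 7 / 5 ≤ q := by
    have : 14 / 5 ≤ √((2 : ℝ) ^ d) := Real.le_sqrt_of_sq_le (by
      have : (2 : ℝ) ^ 3 ≤ 2 ^ d := pow_le_pow_right₀ (by norm_num) hd
      linarith)
    rw [hq]
    linarith
  have hgeom : ∑ k ∈ Finset.range (K + 1), q ^ k ≤ 4 * q ^ K := by
    rw [geom_sum_eq (by linarith), div_le_iff₀ (by linarith), pow_succ]
    nlinarith [pow_pos (by linarith : 0 < q) K]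
  calc _ ≤ 8 / (m : ℝ) * (5 * (2 * (m : ℝ) ^ (-(1 : ℝ) / d) * m)) := by
        refine mul_le_mul_of_nonneg_left ?_ (by positivity)
        have h1 := mul_le_mul_of_nonneg_left hgeom (Real.sqrt_nonneg (m : ℝ))
        have h2 := mul_le_mul_of_nonneg_right hhalf (by linarith : (0 : ℝ) ≤ m)
        linarith
    _ = _ := by
        field_simp
        norm_num

end Scales

end PSMM

/-! ### Assembly of the three regimes -/

theorem mainTheorem6 (a b : ℝ) (ha : 0 < a) (hb : 0 < b) :
    ∃ C : ℝ, 0 < C ∧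
      ∀ (d n m : ℕ) (ε : ℝ), 0 < d → 0 < n → 0 < ε → m = ⌈ε * (n : ℝ)⌉₊ →
      ∀ (cell : Fin m → Set (PSMM.Cube d)), PSMM.IsPartition cell →
      (∀ i, a * (m : ℝ) ^ (-(1 : ℝ) / (d : ℝ)) ≤ Metric.diam (cell i) ∧
        Metric.diam (cell i) ≤ b * (m : ℝ) ^ (-(1 : ℝ) / (d : ℝ))) →
      ∀ (y : Fin m → PSMM.Cube d), (∀ i, y i ∈ cell i) →
      ∀ (x : Fin n → PSMM.Cube d)
        {S : Type*} [MeasurableSpace S] (P : Measure S) [IsProbabilityMeasure P]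
        (νhat : S → ProbabilityMeasure (PSMM.Cube d)),
        PSMM.IsOutput P ε cell y x νhat →
        (d = 1 →
          ∫⁻ s, PSMM.wasserstein (PSMM.empirical x) (νhat s : Measure (PSMM.Cube d)) ∂P ≤
            ENNReal.ofReal (C * (ε * (n : ℝ)) ^ (-(1 : ℝ) / 2))) ∧
        (d = 2 → 2 ≤ ε * (n : ℝ) →
          ∫⁻ s, PSMM.wasserstein (PSMM.empirical x) (νhat s : Measure (PSMM.Cube d)) ∂P ≤
            ENNReal.ofReal
              (C * Real.log (ε * (n : ℝ)) * (ε * (n : ℝ)) ^ (-(1 : ℝ) / 2))) ∧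
        (3 ≤ d →
          ∫⁻ s, PSMM.wasserstein (PSMM.empirical x) (νhat s : Measure (PSMM.Cube d)) ∂P ≤
            ENNReal.ofReal (C * (ε * (n : ℝ)) ^ (-(1 : ℝ) / (d : ℝ)))) := by
  -- 80 comes from the level optimisation and b from the mesh; the factor 2 is needed for d = 2,
  -- where `1 ≤ 2 log T` since `T ≥ 2`.
  refine ⟨80 + 2 * b, by positivity, ?_⟩
  intro d n m ε hd hn hε hm cell hcell hdiam y hy x S _ P _ νhat hout
  have hT : 0 < ε * (n : ℝ) := by positivity
  have hmT : ε * (n : ℝ) ≤ m := by rw [hm]; exact Nat.le_ceil _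
  have hm0 : 0 < m := by rw [hm]; exact Nat.ceil_pos.2 hT
  have hm0' : (0 : ℝ) < m := by exact_mod_cast hm0
  have hm1 : (1 : ℝ) ≤ m := by exact_mod_cast hm0
  set T : ℝ := ε * (n : ℝ) with hTdef
  have hpow : ∀ r : ℝ, r ≤ 0 → (m : ℝ) ^ r ≤ T ^ r := fun r hr =>
    Real.rpow_le_rpow_of_nonpos hT hmT hr
  have hgen : ∀ K : ℕ, 1 ≤ T →
      ∫⁻ s, PSMM.wasserstein (PSMM.empirical x) (νhat s : Measure (PSMM.Cube d)) ∂P ≤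
        ENNReal.ofReal (b * (m : ℝ) ^ (-(1 : ℝ) / (d : ℝ)) + 8 / (m : ℝ) *
          (∑ k ∈ Finset.range (K + 1), (1 / 2) ^ k * √((2 ^ k) ^ d * (m : ℝ)) +
            (1 / 2) ^ K * m)) := fun K h1 => by
    refine (PSMM.lintegral_wasserstein_le hn hm0 hε hcell (by positivity)
      (fun i => (hdiam i).2) hy x P νhat hout K).trans (ENNReal.ofReal_le_ofReal ?_)
    -- For T ≥ 1, rounding up at most doubles: m < T + 1 ≤ 2T.
    have h2 : 4 / T ≤ 8 / (m : ℝ) := by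
      rw [div_le_div_iff₀ hT hm0']
      have : (m : ℝ) < T + 1 := by rw [hm]; exact Nat.ceil_lt_add_one hT.le
      linarith
    gcongr
  have hsmall : T < 1 → ∀ r : ℝ, r ≤ 0 →
      ∫⁻ s, PSMM.wasserstein (PSMM.empirical x) (νhat s : Measure (PSMM.Cube d)) ∂P ≤
        ENNReal.ofReal ((80 + 2 * b) * T ^ r) := fun h1 r hr => by
    have := PSMM.isProbabilityMeasure_empirical hn x
    calc _ ≤ ∫⁻ _, 1 ∂P := lintegral_mono fun s => PSMM.wasserstein_cube_le_one _ _
      _ = ENNReal.ofReal 1 := by simp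
      _ ≤ _ := ENNReal.ofReal_le_ofReal (by
        have := Real.one_le_rpow_of_pos_of_le_one_of_nonpos hT h1.le hr
        nlinarith)
  have hhalf : (-(1 : ℝ) / 2) ≤ 0 := by norm_num
  refine ⟨fun h => ?_, fun h h2 => ?_, fun h => ?_⟩
  · subst h
    rcases lt_or_ge T 1 with h1 | h1
    · exact hsmall h1 _ hhalf
    · obtain ⟨K, hK⟩ := PSMM.exists_level_dim_one hm0
      refine (hgen K h1).trans (ENNReal.ofReal_le_ofReal ?_)
      have e1 : (m : ℝ) ^ (-(1 : ℝ) / ((1 : ℕ) : ℝ)) ≤ (m : ℝ) ^ (-(1 : ℝ) / 2) :=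
        Real.rpow_le_rpow_of_exponent_le hm1 (by norm_num)
      nlinarith [hpow _ hhalf, mul_le_mul_of_nonneg_left e1 hb.le,
        Real.rpow_nonneg hT.le (-(1 : ℝ) / 2)]
  · subst h
    obtain ⟨K, hK⟩ := PSMM.exists_level_dim_two hm0
    refine (hgen K (by linarith)).trans (ENNReal.ofReal_le_ofReal ?_)
    have hl2 : 1 / 2 < Real.log 2 := by linarith [Real.log_two_gt_d9]
    have hlT : Real.log 2 ≤ Real.log T := Real.log_le_log (by norm_num) h2
    have hlm : Real.log m ≤ 2 * Real.log T := by
      have h3 : (m : ℝ) ≤ T ^ 2 := by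
        have : (m : ℝ) < T + 1 := by rw [hm]; exact Nat.ceil_lt_add_one hT.le
        nlinarith
      have := Real.log_le_log hm0' h3
      rw [Real.log_pow] at this
      exact_mod_cast this
    -- Both terms are multiples of `log T / log 2`, with total factor 5, and `log 2 > 1/2`.
    have hcoef : Real.log m / Real.log 2 + 3 ≤ 10 * Real.log T := by
      have h4 : Real.log m / Real.log 2 ≤ 2 * Real.log T / Real.log 2 := by gcongr
      have h5 : 3 ≤ 3 * Real.log T / Real.log 2 := by
        rw [le_div_iff₀ (by linarith)]
        linarith
      have h6 : 2 * Real.log T / Real.log 2 + 3 * Real.log T / Real.log 2 ≤ 10 * Real.log T := by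
        rw [← add_div, div_le_iff₀ (by linarith)]
        nlinarith
      linarith
    have e2 : ((2 : ℕ) : ℝ) = 2 := by norm_num
    rw [e2]
    have hmp : (0 : ℝ) ≤ (m : ℝ) ^ (-(1 : ℝ) / 2) := by positivity
    calc _ ≤ 2 * b * Real.log T * (m : ℝ) ^ (-(1 : ℝ) / 2) +
          8 * (10 * Real.log T) * (m : ℝ) ^ (-(1 : ℝ) / 2) := by
          refine add_le_add (mul_le_mul_of_nonneg_right (by nlinarith) hmp) (hK.trans ?_)
          gcongr
      _ = (80 + 2 * b) * Real.log T * (m : ℝ) ^ (-(1 : ℝ) / 2) := by ring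
      _ ≤ _ := mul_le_mul_of_nonneg_left (hpow _ hhalf)
          (mul_nonneg (by positivity) (by linarith))
  · have hneg : -(1 : ℝ) / (d : ℝ) ≤ 0 := div_nonpos_of_nonpos_of_nonneg (by norm_num) (by simp)
    rcases lt_or_ge T 1 with h1 | h1
    · exact hsmall h1 _ hneg
    · obtain ⟨K, hK⟩ := PSMM.exists_level_of_three_le h hm0
      refine (hgen K h1).trans (ENNReal.ofReal_le_ofReal ?_)
      nlinarith [hpow _ hneg, mul_le_mul_of_nonneg_left (hpow _ hneg) hb.le,
        Real.rpow_nonneg hT.le (-(1 : ℝ) / (d : ℝ))]
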